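/- Let $k$ be an algebraically closed field of characteristic $0$. Varieties in $\mathbb P^N=\mathbb P^N_k$ are irreducible closed subsets with their reduced structure, and points are closed points. An $n$-dimensional variety $P\subset\mathbb P^N$ is a \emph{scroll} if there exist a smooth irreducible projective curve $B$ over $k$, a (Zariski-locally trivial) $\mathbb P^{n-1}$-bundle $\pi:\Lambda\to B$ and a $k$-morphism $\varphi:\Lambda\to\mathbb P^N$ such that $\varphi$ restricts to a linear embedding on each fibre $\Lambda_b=\pi^{-1}(b)$, $b\in B$, such that $\varphi(\Lambda)=P$, and such that $\varphi$ is birational onto its image. The linear spaces $\varphi(\Lambda_b)$, $b\in B$, are called the \emph{rulings} of $P$. A \emph{cone} with vertex $c$ is a pair $(C,c)$, where $C\subset\mathbb P^N$ is a closed subset and $c\in C$ is a point, such that for every point $q\in C\setminus\{c\}$ the line joining $q$ and $c$ is contained in $C$. \textbf{Proposition.} Let $P\subset\mathbb P^N$ be an $n$-dimensional scroll, with data $(B,\pi,\varphi)$ as above, which is not a linear space, and let $p\in P$ be a point that is contained in only finitely many of the rulings. Let $(C,p)$ be a cone with vertex $p$ such that $C$ is irreducible of dimension $n-1$ and $C\subset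 P$. Then $C$ is a linear space. -/

import Mathlib

open AlgebraicGeometry CategoryTheory CategoryTheory.Limits

universe u

noncomputable section

namespace ScrollCone

attribute [local instance] MvPolynomial.gradedAlgebra

/-- The projective space over `k` with homogeneous coordinates indexed by `ι`, that is
`Proj k[xᵢ : i ∈ ι]`. Thus `ℙ^N` is `PSpace k (Fin (N + 1))` and, for `n ≥ 1`,
`ℙ^(n-1)` is `PSpace k (Fin n)`. -/
abbrev PSpace (k : Type u) [Field k] (ι : Type) : Scheme.{u} :=
  Proj (MvPolynomial.homogeneousSubmodule ι k)

/-- The structure morphism of projective space over `Spec k`. -/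
def PSpace.toBase (k : Type u) [Field k] (ι : Type) :
    PSpace k ι ⟶ Spec (CommRingCat.of k) :=
  Proj.toSpecZero (MvPolynomial.homogeneousSubmodule ι k) ≫
    Spec.map (CommRingCat.ofHom (algebraMap k (MvPolynomial.homogeneousSubmodule ι k 0)))

section Linear

variable {k : Type u} [Field k] {ι : Type}

/-- The common zero locus in projective space of a set `S` of polynomials. -/
def zeros (S : Set (MvPolynomial ι k)) : Set (PSpace k ι) :=
  {x | ∀ f ∈ S, f ∈ x.asHomogeneousIdeal}

/-- A linear space in projective space: the common zero locus of a set of linear forms. -/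
def IsLinearSpace (L : Set (PSpace k ι)) : Prop :=
  ∃ S : Set (MvPolynomial ι k), (∀ f ∈ S, f.IsHomogeneous 1) ∧ L = zeros S

/-- The linear span of a set of points: the zero locus of all linear forms vanishing on it. -/
def linearSpan (A : Set (PSpace k ι)) : Set (PSpace k ι) :=
  zeros {f | f.IsHomogeneous 1 ∧ ∀ x ∈ A, f ∈ x.asHomogeneousIdeal}

/-- The line joining two (distinct, closed) points. -/
def lineJoining (p q : PSpace k ι) : Set (PSpace k ι) :=
  linearSpan {p, q}

/-- `(C, c)` is a cone: `C` is a closed subset of projective space, `c` is a (closed) point of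
`C`, and for every (closed) point `q ≠ c` of `C` the line joining `c` and `q` lies in `C`. -/
structure IsCone (C : Set (PSpace k ι)) (c : PSpace k ι) : Prop where
  isClosed : IsClosed C
  isClosed_vertex : IsClosed ({c} : Set (PSpace k ι))
  vertex_mem : c ∈ C
  line_subset : ∀ q ∈ C, IsClosed ({q} : Set (PSpace k ι)) → q ≠ c → lineJoining c q ⊆ C

end Linear

/-- `sB : B ⟶ Spec k` is a smooth irreducible projective curve over `k`. -/
structure IsSmoothProjectiveCurve {k : Type u} [Field k] {B : Scheme.{u}}
    (sB : B ⟶ Spec (CommRingCat.of k)) : Prop where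
  smooth : Smooth sB
  irreducible : IrreducibleSpace B
  dim_eq_one : topologicalKrullDim B = 1
  projective : ∃ (M : ℕ) (j : B ⟶ PSpace k (Fin (M + 1))),
    IsClosedImmersion j ∧ j ≫ PSpace.toBase k (Fin (M + 1)) = sB

/-- `π : Λ ⟶ B` is a `ℙ^(n-1)`-bundle over the `k`-scheme `B`: every point of `B` has an open
neighbourhood `U` such that `π⁻¹(U)` is isomorphic to `ℙ^(n-1) × U` over `U`. -/
def IsProjectiveBundle {k : Type u} [Field k] (n : ℕ) {B Λ : Scheme.{u}}
    (sB : B ⟶ Spec (CommRingCat.of k)) (π : Λ ⟶ B) : Prop :=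
  ∀ b : B, ∃ U : B.Opens, b ∈ U ∧
    ∃ e : (π ⁻¹ᵁ U).toScheme ≅ pullback (PSpace.toBase k (Fin n)) (U.ι ≫ sB),
      e.hom ≫ pullback.snd (PSpace.toBase k (Fin n)) (U.ι ≫ sB) = π ∣_ U

/-- A morphism is birational onto its image if it restricts to an isomorphism over some dense
open subscheme of its scheme-theoretic image. -/
def IsBirationalOntoImage {X Y : Scheme.{u}} (f : X ⟶ Y) : Prop :=
  ∃ V : f.image.Opens, Dense (V : Set f.image) ∧
    Dense ((f.toImage ⁻¹ᵁ V : X.Opens) : Set X) ∧ IsIso (f.toImage ∣_ V)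

/-- The data exhibiting an `n`-dimensional variety `P ⊆ ℙ^N` as a scroll: a smooth irreducible
projective curve `B`, a `ℙ^(n-1)`-bundle `π : Λ ⟶ B` and a morphism `φ : Λ ⟶ ℙ^N` which is a
linear embedding on each fibre of `π` and which is birational onto its image `P`.
A variety is an irreducible closed subset (with its reduced structure). -/
structure Scroll (k : Type u) [Field k] (n N : ℕ) (P : Set (PSpace k (Fin (N + 1)))) where
  isClosed : IsClosed P
  isIrreducible : IsIrreducible P
  dim_eq : topologicalKrullDim P = n
  /-- the base curve -/
  B : Scheme.{u}
  /-- the structure morphism of the base curve -/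
  sB : B ⟶ Spec (CommRingCat.of k)
  isCurve : IsSmoothProjectiveCurve sB
  /-- the total space of the projective bundle -/
  Λ : Scheme.{u}
  /-- the bundle projection -/
  π : Λ ⟶ B
  isBundle : IsProjectiveBundle n sB π
  /-- the map to projective space -/
  φ : Λ ⟶ PSpace k (Fin (N + 1))
  φ_over : φ ≫ PSpace.toBase k (Fin (N + 1)) = π ≫ sB
  fibre_closedImmersion : ∀ b : B, IsClosed ({b} : Set B) → IsClosedImmersion (π.fiberι b ≫ φ)
  fibre_linear : ∀ b : B, IsClosed ({b} : Set B) →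
    IsLinearSpace (Set.range (π.fiberι b ≫ φ))
  range_eq : Set.range φ = P
  birational : IsBirationalOntoImage φ

/-- The subset `φ(Λ_b)` of `ℙ^N`. -/
def Scroll.ruling {k : Type u} [Field k] {n N : ℕ} {P : Set (PSpace k (Fin (N + 1)))}
    (S : Scroll k n N P) (b : S.B) : Set (PSpace k (Fin (N + 1))) :=
  S.φ '' (S.π ⁻¹' {b})

/-- The set of rulings of a scroll: the linear spaces `φ(Λ_b)` for the (closed) points `b`
of the base curve. -/
def Scroll.rulings {k : Type u} [Field k] {n N : ℕ} {P : Set (PSpace k (Fin (N + 1)))}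
    (S : Scroll k n N P) : Set (Set (PSpace k (Fin (N + 1)))) :=
  {L | ∃ b : S.B, IsClosed ({b} : Set S.B) ∧ L = S.ruling b}

end ScrollCone

end

noncomputable section

namespace ScrollCone

attribute [local instance] MvPolynomial.gradedAlgebra

/-! ### Projective space over `Spec k`: proper, universally open, Jacobson. -/

section Base

variable (k : Type u) [Field k] (ι : Type)

/-! Let `L` be a ruling avoiding `p`, and `q ≠ p` a closed point of `C`. The line `pq` lies in `C ⊆
P`. Since `π` is closed and `B` is a curve, this line either lies in a ruling, necessarily one of
the finitely many through `p`, or meets every ruling (`Scroll.exists_ruling_or_forall_ruling`). In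
the second case it meets `L`, so `q` lies in the span of `p` and `L`
(`mem_linZeros_linearFormsOn_union`). By irreducibility, `C` lies in one ruling, and equals it by
dimension, or `C` lies in the span of `p` and `L` for every such `L` (`Scroll.cone_subset`).

In the latter case that span has dimension at most `n`. If the span of `C` has dimension `n - 1`, it
equals `C`. Otherwise it equals the span of `p` and `L`, hence contains every ruling avoiding `p`.
These rulings are dense in `P` (`Scroll.subset_of_forall_ruling_subset`), so `P` would be the span
of `C`, against the non-linearity of `P`. -/

lemma bijective_algebraMap_homogeneousSubmodule_zero :
    Function.Bijective (algebraMap k (MvPolynomial.homogeneousSubmodule ι k 0)) := by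
  refine ⟨fun x y h ↦ MvPolynomial.C_injective ι k (congrArg Subtype.val h), fun x ↦ ?_⟩
  obtain ⟨x, hx⟩ := x
  have hx' := hx
  rw [MvPolynomial.homogeneousSubmodule_zero, Submodule.mem_one] at hx'
  obtain ⟨y, hy⟩ := hx'
  exact ⟨y, Subtype.ext hy⟩

instance finiteType_homogeneousSubmodule_zero [Finite ι] :
    Algebra.FiniteType (MvPolynomial.homogeneousSubmodule ι k 0) (MvPolynomial ι k) := by
  have : IsScalarTower k (MvPolynomial.homogeneousSubmodule ι k 0) (MvPolynomial ι k) :=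
    IsScalarTower.of_algebraMap_eq (R := k)
      (S := MvPolynomial.homogeneousSubmodule ι k 0) fun _ ↦ rfl
  exact Algebra.FiniteType.of_restrictScalars_finiteType k _ _

instance isIso_specMap_algebraMap_homogeneousSubmodule_zero :
    IsIso (Spec.map (CommRingCat.ofHom
      (algebraMap k (MvPolynomial.homogeneousSubmodule ι k 0)))) := by
  have : IsIso (CommRingCat.ofHom
      (algebraMap k (MvPolynomial.homogeneousSubmodule ι k 0))) := by
    rw [ConcreteCategory.isIso_iff_bijective]
    exact bijective_algebraMap_homogeneousSubmodule_zero k ι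
  infer_instance

instance isProper_toBase [Finite ι] : IsProper (PSpace.toBase k ι) := by
  unfold PSpace.toBase; infer_instance

/-- Flatness is automatic over the one-point integral scheme `Spec k`; flat and locally of finite
presentation gives open. -/
instance universallyOpen_toBase [Finite ι] : UniversallyOpen (PSpace.toBase k ι) := by
  have : LocallyOfFinitePresentation (PSpace.toBase k ι) :=
    LocallyOfFinitePresentation.iff_locallyOfFiniteType.mpr inferInstance
  have : Flat (PSpace.toBase k ι) := by
    have : IsIntegral (Spec (CommRingCat.of k)) := inferInstance
    have : Subsingleton (Spec (CommRingCat.of k)) :=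
      inferInstanceAs (Subsingleton (PrimeSpectrum k))
    infer_instance
  infer_instance

instance jacobsonSpace_pSpace [Finite ι] : JacobsonSpace (PSpace k ι) :=
  LocallyOfFiniteType.jacobsonSpace (PSpace.toBase k ι)

end Base

/-! ### Values of linear forms at closed points. -/

section ClosedPoint

variable {k : Type u} [Field k] [IsAlgClosed k] {ι : Type} [Finite ι]

open MvPolynomial

/-- Over an algebraically closed field a closed point is rational, so the ratio `h / w` has a value
`a` in `k` at `p`. -/
lemma exists_sub_smul_mem_of_isClosed_singleton {p : PSpace k ι}
    (hp : IsClosed ({p} : Set (PSpace k ι))) {w h : MvPolynomial ι k}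
    (hw : w.IsHomogeneous 1) (hh : h.IsHomogeneous 1) (hwp : w ∉ p.asHomogeneousIdeal) :
    ∃ a : k, h - a • w ∈ p.asHomogeneousIdeal := by
  let 𝒜 := homogeneousSubmodule ι k
  have hw' : w ∈ 𝒜 1 := hw
  let ψ : k →+* HomogeneousLocalization.Away 𝒜 w :=
    (HomogeneousLocalization.fromZeroRingHom 𝒜 (Submonoid.powers w)).comp (algebraMap k (𝒜 0))
  have hψ : Proj.awayι 𝒜 w hw' one_pos ≫ PSpace.toBase k ι =
      Spec.map (CommRingCat.ofHom ψ) := by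
    rw [PSpace.toBase, Proj.awayι_toSpecZero_assoc, ← Spec.map_comp]
    rfl
  obtain ⟨x, hx⟩ : p ∈ Set.range (Proj.awayι 𝒜 w hw' one_pos) := by
    have := Proj.opensRange_awayι 𝒜 w hw' one_pos
    rw [← Scheme.Hom.coe_opensRange, this]
    exact (Proj.mem_basicOpen 𝒜 w p).mpr hwp
  have hxc : IsClosed ({x} : Set (Spec (.of (HomogeneousLocalization.Away 𝒜 w)))) := by
    rw [← Set.preimage_image_eq {x} (Proj.awayι 𝒜 w hw' one_pos).isOpenEmbedding.injective,
      Set.image_singleton, hx]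
    exact hp.preimage (Proj.awayι 𝒜 w hw' one_pos).continuous
  have : LocallyOfFiniteType (Spec.map (CommRingCat.ofHom ψ)) := by
    rw [← hψ]; infer_instance
  -- The rational point `s` corresponds to a ring map `χ`, evaluation at `p` of degree-zero
  -- fractions with denominators powers of `w`.
  let s := pointOfClosedPoint (Spec.map (CommRingCat.ofHom ψ)) x hxc
  let χ := Spec.preimage s
  have hs : Spec.map χ = s := Spec.map_preimage s
  have hχψ : CommRingCat.ofHom ψ ≫ χ = 𝟙 _ := by
    apply Spec.map_injective
    rw [Spec.map_comp, hs, Spec.map_id]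
    exact pointOfClosedPoint_comp _ x hxc
  have hχ (y) (hy : χ.hom y = 0) : y ∈ x.asIdeal := by
    have : Spec.map χ (IsLocalRing.closedPoint k) = x := by
      rw [hs]; exact pointOfClosedPoint_apply _ x hxc _
    rw [← this]
    change χ.hom y ∈ (IsLocalRing.closedPoint k).asIdeal
    rw [hy]
    exact zero_mem _
  let y := HomogeneousLocalization.Away.isLocalizationElem hw' (show h ∈ 𝒜 1 from hh)
  refine ⟨χ.hom y, by_contra fun hn ↦ ?_⟩
  set a := χ.hom y with ha
  have hg : h - a • w ∈ 𝒜 1 := sub_mem hh (Submodule.smul_mem _ a hw')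
  have hpre := Proj.awayι_preimage_basicOpen 𝒜 hw' one_pos hg one_pos
  have hmem : x ∈ Proj.awayι 𝒜 w hw' one_pos ⁻¹ᵁ Proj.basicOpen 𝒜 (h - a • w) := by
    change (Proj.awayι 𝒜 w hw' one_pos) x ∈ Proj.basicOpen 𝒜 (h - a • w)
    rw [hx]
    exact (Proj.mem_basicOpen 𝒜 _ p).mpr hn
  rw [hpre] at hmem
  refine hmem (hχ _ ?_)
  have hya : HomogeneousLocalization.Away.isLocalizationElem hw' hg = y - ψ a := by
    apply HomogeneousLocalization.val_injective
    rw [HomogeneousLocalization.val_sub]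
    simp only [y, ψ, HomogeneousLocalization.Away.isLocalizationElem,
      HomogeneousLocalization.Away.val_mk, RingHom.comp_apply]
    change _ = _ - Localization.mk (C a) 1
    rw [eq_sub_iff_add_eq, Localization.add_mk, Localization.mk_eq_mk_iff,
      Localization.r_iff_exists]
    refine ⟨1, ?_⟩
    simp only [smul_eq_C_mul, pow_one, OneMemClass.coe_one, one_mul, mul_one]
    ring
  rw [hya, map_sub, sub_eq_zero, ← ha]
  exact congr($(hχψ) a).symm

end ClosedPoint

/-! ### Krull dimension of subsets. -/

section Dimension

open TopologicalSpace

variable {X : Type*} [TopologicalSpace X]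

lemma topologicalKrullDim_empty : topologicalKrullDim (∅ : Set X) = ⊥ :=
  have : IsEmpty (IrreducibleCloseds (∅ : Set X)) :=
    ⟨fun s ↦ by obtain ⟨x, -⟩ := s.2.nonempty; exact x.2⟩
  Order.krullDim_eq_bot

/-- Any chain of irreducible closed subsets of `Y` extends by `Z` on top; `WithTop` encodes the
extra element. -/
lemma topologicalKrullDim_add_one_le_of_ssubset {Y Z : Set X} (hY : IsClosed Y)
    (hZ : IsIrreducible Z) (hYZ : Y ⊂ Z) :
    topologicalKrullDim Y + 1 ≤ topologicalKrullDim Z := by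
  rcases Y.eq_empty_or_nonempty with rfl | ⟨y, hy⟩
  · simp [topologicalKrullDim_empty]
  have : Nonempty (IrreducibleCloseds Y) :=
    ⟨⟨closure {⟨y, hy⟩}, isIrreducible_singleton.closure, isClosed_closure⟩⟩
  have : IrreducibleSpace Z := Subtype.irreducibleSpace hZ
  let T : IrreducibleCloseds Z := ⟨Set.univ, IrreducibleSpace.isIrreducible_univ Z, isClosed_univ⟩
  let i : Y → Z := Set.inclusion hYZ.subset
  have hi : Topology.IsInducing i := (Topology.IsEmbedding.inclusion hYZ.subset).isInducing
  have hlt (W : IrreducibleCloseds Y) : IrreducibleCloseds.map i hi.continuous W < T := by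
    obtain ⟨z, hz, hzY⟩ := Set.exists_of_ssubset hYZ
    have hrange : IsClosed (Set.range i) := by
      rw [Set.range_inclusion]
      exact hY.preimage continuous_subtype_val
    refine lt_of_le_of_ne (fun _ _ ↦ Set.mem_univ _) fun h ↦ hzY ?_
    have h1 : (⟨z, hz⟩ : Z) ∈ (IrreducibleCloseds.map i hi.continuous W : Set Z) := by
      rw [h]; exact Set.mem_univ _
    have h2 : (⟨z, hz⟩ : Z) ∈ Set.range i :=
      closure_minimal (Set.image_subset_range _ _) hrange h1
    rwa [Set.range_inclusion] at h2
  rw [topologicalKrullDim, topologicalKrullDim, ← Order.krullDim_WithTop]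
  refine Order.krullDim_le_of_strictMono
    (fun W : WithTop (IrreducibleCloseds Y) ↦
      W.recTopCoe T (IrreducibleCloseds.map i hi.continuous)) ?_
  intro a b hab
  induction b with
  | top =>
    lift a to IrreducibleCloseds Y using hab.ne
    exact hlt a
  | coe b =>
    lift a to IrreducibleCloseds Y using (hab.trans (WithTop.coe_lt_top b)).ne
    exact IrreducibleCloseds.map_strictMono_of_isInducing hi (WithTop.coe_lt_coe.mp hab)

/-- The natural number `d` rules out infinite dimension, where `d + 1 ≤ d` would be no
contradiction. -/
lemma eq_of_subset_of_topologicalKrullDim_le {Y Z : Set X} (hY : IsClosed Y)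
    (hZ : IsIrreducible Z) (hYZ : Y ⊆ Z) {d : ℕ}
    (hd : d ≤ topologicalKrullDim Y) (hd' : topologicalKrullDim Z ≤ d) : Y = Z := by
  by_contra hne
  have h1 := topologicalKrullDim_add_one_le_of_ssubset hY hZ (hYZ.ssubset_of_ne hne)
  have h2 : (d : WithBot ℕ∞) + 1 ≤ d := (add_le_add_left hd 1).trans (h1.trans hd')
  have h3 : ((d + 1 : ℕ) : WithBot ℕ∞) ≤ (d : ℕ) := by exact_mod_cast h2
  have : d + 1 ≤ d := by exact_mod_cast h3
  omega

lemma topologicalKrullDim_mono {Y Z : Set X} (h : Y ⊆ Z) :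
    topologicalKrullDim Y ≤ topologicalKrullDim Z :=
  (Topology.IsEmbedding.inclusion h).isInducing.topologicalKrullDim_le

lemma zero_le_topologicalKrullDim {Y : Set X} (hY : Y.Nonempty) :
    0 ≤ topologicalKrullDim Y := by
  obtain ⟨y, hy⟩ := hY
  have : Nonempty (IrreducibleCloseds Y) :=
    ⟨⟨closure {⟨y, hy⟩}, isIrreducible_singleton.closure, isClosed_closure⟩⟩
  exact Order.krullDim_nonneg

end Dimension

/-! ### Linear spaces, their ideals and their dimension. -/

section LinearForms

variable {k : Type u} [Field k] {ι : Type}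

open MvPolynomial

lemma mem_zeros {S : Set (MvPolynomial ι k)} {x : PSpace k ι} :
    x ∈ zeros S ↔ ∀ f ∈ S, f ∈ x.asHomogeneousIdeal := Iff.rfl

lemma isClosed_zeros (S : Set (MvPolynomial ι k)) : IsClosed (zeros S) :=
  ProjectiveSpectrum.isClosed_zeroLocus (homogeneousSubmodule ι k) S

variable (k ι) in
/-- The space of linear forms in the variables indexed by `ι`. -/
abbrev LinForm : Submodule k (MvPolynomial ι k) := homogeneousSubmodule ι k 1

/-- The linear forms vanishing on a set of points. -/
def linearFormsOn (A : Set (PSpace k ι)) : Submodule k (LinForm k ι) where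
  carrier := {f | ∀ x ∈ A, f.1 ∈ x.asHomogeneousIdeal}
  zero_mem' x _ := zero_mem x.asHomogeneousIdeal.toIdeal
  add_mem' hf hg x hx := add_mem (S := Ideal _) (hf x hx) (hg x hx)
  smul_mem' c f hf x hx := by
    rw [Submodule.coe_smul, smul_eq_C_mul]
    exact Ideal.mul_mem_left x.asHomogeneousIdeal.toIdeal _ (hf x hx)

lemma mem_linearFormsOn {A : Set (PSpace k ι)} {f : LinForm k ι} :
    f ∈ linearFormsOn A ↔ ∀ x ∈ A, f.1 ∈ x.asHomogeneousIdeal := Iff.rfl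

lemma mem_linearFormsOn_singleton {p : PSpace k ι} {f : LinForm k ι} :
    f ∈ linearFormsOn {p} ↔ f.1 ∈ p.asHomogeneousIdeal := by
  simp [mem_linearFormsOn]

/-- The linear space cut out by a space of linear forms. -/
def linZeros (W : Submodule k (LinForm k ι)) : Set (PSpace k ι) :=
  zeros (Subtype.val '' (W : Set (LinForm k ι)))

lemma mem_linZeros {W : Submodule k (LinForm k ι)} {x : PSpace k ι} :
    x ∈ linZeros W ↔ ∀ f ∈ W, f.1 ∈ x.asHomogeneousIdeal := by
  simp [linZeros, mem_zeros]

lemma isClosed_linZeros (W : Submodule k (LinForm k ι)) : IsClosed (linZeros W) :=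
  isClosed_zeros _

lemma isLinearSpace_linZeros (W : Submodule k (LinForm k ι)) : IsLinearSpace (linZeros W) :=
  ⟨_, by rintro _ ⟨f, -, rfl⟩; exact f.2, rfl⟩

lemma subset_linZeros_iff {A : Set (PSpace k ι)} {W : Submodule k (LinForm k ι)} :
    A ⊆ linZeros W ↔ W ≤ linearFormsOn A :=
  ⟨fun h _ hf _ hx ↦ mem_linZeros.mp (h hx) _ hf, fun h _ hx ↦ mem_linZeros.mpr
    fun _ hf ↦ h hf _ hx⟩

lemma linearFormsOn_anti {A A' : Set (PSpace k ι)} (h : A ⊆ A') :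
    linearFormsOn A' ≤ linearFormsOn A := fun _ hf x hx ↦ hf x (h hx)

lemma linZeros_anti {W W' : Submodule k (LinForm k ι)} (h : W ≤ W') :
    linZeros W' ⊆ linZeros W := fun _ hx ↦ mem_linZeros.mpr fun f hf ↦ mem_linZeros.mp hx f (h hf)

lemma linearSpan_eq (A : Set (PSpace k ι)) : linearSpan A = linZeros (linearFormsOn A) := by
  ext x
  simp only [linearSpan, mem_zeros, mem_linZeros, Set.mem_ofPred_eq]
  exact ⟨fun h f hf ↦ h f.1 ⟨f.2, hf⟩, fun h f hf ↦ h ⟨f, hf.1⟩ hf.2⟩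

lemma IsLinearSpace.eq_linZeros {L : Set (PSpace k ι)} (hL : IsLinearSpace L) :
    L = linZeros (linearFormsOn L) := by
  obtain ⟨S, hS, rfl⟩ := hL
  refine (subset_linZeros_iff.mpr le_rfl).antisymm fun x hx f hf ↦ ?_
  exact mem_linZeros.mp hx ⟨f, hS f hf⟩ fun y hy ↦ hy f hf

lemma IsLinearSpace.isClosed {L : Set (PSpace k ι)} (hL : IsLinearSpace L) :
    IsClosed L := by
  rw [hL.eq_linZeros]
  exact isClosed_linZeros _

/-- The ideal generated by a space of linear forms. -/
def linIdeal (W : Submodule k (LinForm k ι)) : Ideal (MvPolynomial ι k) :=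
  Ideal.span (Subtype.val '' (W : Set (LinForm k ι)))

lemma linForm_hom_ext {M : Type*} [AddCommGroup M] [Module k M] {g h : LinForm k ι →ₗ[k] M}
    (H : ∀ i, g ⟨X i, isHomogeneous_X k i⟩ = h ⟨X i, isHomogeneous_X k i⟩) : g = h := by
  refine LinearMap.ext_on (s := Set.range fun i ↦ (⟨X i, isHomogeneous_X k i⟩ : LinForm k ι)) ?_ ?_
  · apply Submodule.map_injective_of_injective (LinForm k ι).subtype_injective
    rw [Submodule.map_span, Submodule.map_top, Submodule.range_subtype, ← Set.range_comp]
    exact homogeneousSubmodule_one_eq_span_X.symm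
  · rintro _ ⟨i, rfl⟩
    exact H i

/-- The ideal of a space of linear forms is the kernel of the substitution given by a projection
along that space. -/
lemma exists_algHom_ker_eq_linIdeal (W : Submodule k (LinForm k ι)) :
    ∃ ε : MvPolynomial ι k →ₐ[k] MvPolynomial ι k, RingHom.ker ε = linIdeal W ∧
      ∀ f : LinForm k ι, f ∈ W ↔ ε f.1 = 0 := by
  obtain ⟨W', hW⟩ := W.exists_isCompl
  let e : LinForm k ι →ₗ[k] LinForm k ι := W'.subtype ∘ₗ W'.projectionOnto W hW.symm
  have he0 (f) : e f = 0 ↔ f ∈ W := by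
    simp [e]
  have he (f) : f - e f ∈ W := by
    rw [← he0, map_sub, sub_eq_zero]
    exact congrArg Subtype.val (Submodule.projectionOnto_apply_left hW.symm _).symm
  let ε : MvPolynomial ι k →ₐ[k] MvPolynomial ι k :=
    aeval fun i ↦ (e ⟨X i, isHomogeneous_X k i⟩).1
  have hε (f : LinForm k ι) : ε f.1 = (e f).1 := by
    have : ε.toLinearMap ∘ₗ (LinForm k ι).subtype = (LinForm k ι).subtype ∘ₗ e := by
      refine linForm_hom_ext fun i ↦ ?_
      exact aeval_X _ i
    exact congr($this f)
  have hker : ∀ f : LinForm k ι, f ∈ W ↔ ε f.1 = 0 := fun f ↦ by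
    rw [hε, ← he0]; simp
  refine ⟨ε, le_antisymm (fun f hf ↦ ?_) (Ideal.span_le.mpr ?_), hker⟩
  -- Each `X i - e (X i)` lies in `W`, so `ε` is the identity modulo `linIdeal W`; hence `ε f = 0`
  -- forces `f` into that ideal.
  · have : (Ideal.Quotient.mkₐ k (linIdeal W)).comp ε = Ideal.Quotient.mkₐ k (linIdeal W) := by
      ext i
      simp only [AlgHom.comp_apply, Ideal.Quotient.mkₐ_eq_mk]
      symm
      rw [Ideal.Quotient.mk_eq_mk_iff_sub_mem]
      have := he ⟨X i, isHomogeneous_X k i⟩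
      rw [show ε (X i) = (e ⟨X i, isHomogeneous_X k i⟩).1 from hε ⟨X i, isHomogeneous_X k i⟩]
      exact Ideal.subset_span ⟨_, this, rfl⟩
    have h2 := congr($this f)
    simp only [AlgHom.comp_apply, Ideal.Quotient.mkₐ_eq_mk] at h2
    rw [show ε f = 0 from hf, map_zero] at h2
    exact Ideal.Quotient.eq_zero_iff_mem.mp h2.symm
  · rintro _ ⟨f, hf, rfl⟩
    exact (hker f).mp hf

instance isPrime_linIdeal (W : Submodule k (LinForm k ι)) : (linIdeal W).IsPrime := by
  obtain ⟨ε, hε, -⟩ := exists_algHom_ker_eq_linIdeal W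
  rw [← hε]
  exact RingHom.ker_isPrime ε.toRingHom

lemma mem_linIdeal_iff {W : Submodule k (LinForm k ι)} {f : LinForm k ι} :
    f.1 ∈ linIdeal W ↔ f ∈ W := by
  obtain ⟨ε, hε, h⟩ := exists_algHom_ker_eq_linIdeal W
  rw [← hε, h]
  rfl

lemma isHomogeneous_linIdeal (W : Submodule k (LinForm k ι)) :
    (linIdeal W).IsHomogeneous (homogeneousSubmodule ι k) :=
  Ideal.homogeneous_span _ _ <| by rintro _ ⟨f, -, rfl⟩; exact ⟨1, f.2⟩

lemma exists_notMem_of_ne_top {W : Submodule k (LinForm k ι)} (hW : W ≠ ⊤) :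
    ∃ f : LinForm k ι, f ∉ W := by
  simpa [Submodule.eq_top_iff'] using hW

/-- The generic point of a linear space. -/
def linGenericPoint (W : Submodule k (LinForm k ι)) (hW : W ≠ ⊤) : PSpace k ι where
  asHomogeneousIdeal := ⟨linIdeal W, isHomogeneous_linIdeal W⟩
  isPrime := isPrime_linIdeal W
  not_irrelevant_le h := by
    obtain ⟨f, hf⟩ := exists_notMem_of_ne_top hW
    refine hf (mem_linIdeal_iff.mp (h ?_))
    exact HomogeneousIdeal.mem_irrelevant_of_mem _ one_pos f.2

lemma linZeros_eq_closure (W : Submodule k (LinForm k ι)) (hW : W ≠ ⊤) :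
    linZeros W = closure {linGenericPoint W hW} := by
  ext x
  refine Iff.trans ?_ (ProjectiveSpectrum.le_iff_mem_closure _ (linGenericPoint W hW) x)
  refine Iff.trans mem_linZeros ?_
  refine Iff.trans ?_ (Ideal.span_le (I := x.asHomogeneousIdeal.toIdeal)).symm
  simp [Set.subset_def]

lemma isIrreducible_linZeros {W : Submodule k (LinForm k ι)} (hW : W ≠ ⊤) :
    IsIrreducible (linZeros W) := by
  rw [linZeros_eq_closure W hW]
  exact isIrreducible_singleton.closure

/-- A linear Nullstellensatz: test vanishing at the generic point, whose ideal has `W` as its linear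
part. -/
lemma linearFormsOn_linZeros {W : Submodule k (LinForm k ι)} (hW : W ≠ ⊤) :
    linearFormsOn (linZeros W) = W := by
  refine le_antisymm (fun f hf ↦ mem_linIdeal_iff.mp
    (hf (linGenericPoint W hW) ?_)) (subset_linZeros_iff.mp le_rfl)
  rw [linZeros_eq_closure W hW]
  exact subset_closure rfl

/-- Linear forms generate the irrelevant ideal, which no point of `Proj` contains. -/
lemma linearFormsOn_ne_top {A : Set (PSpace k ι)} (hA : A.Nonempty) : linearFormsOn A ≠ ⊤ := by
  obtain ⟨x, hx⟩ := hA
  intro h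
  refine x.not_irrelevant_le ((HomogeneousIdeal.toIdeal_irrelevant_le _).mpr fun i hi ↦ ?_)
  obtain ⟨j, rfl⟩ := Nat.exists_eq_succ_of_ne_zero hi.ne'
  rw [← homogeneousSubmodule_one_pow, pow_succ]
  refine fun f hf ↦ Submodule.mul_induction_on hf (fun a _ b hb ↦ ?_) fun a b ha hb ↦ ?_
  · exact Ideal.mul_mem_left _ _ ((h ▸ Submodule.mem_top :
      (⟨b, hb⟩ : LinForm k ι) ∈ linearFormsOn A) x hx)
  · exact add_mem ha hb

lemma linZeros_ssubset {W W' : Submodule k (LinForm k ι)} (h : W < W') :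
    linZeros W' ⊂ linZeros W := by
  refine (linZeros_anti h.le).ssubset_of_ne fun heq ↦ h.not_ge ?_
  rw [← linearFormsOn_linZeros (h.trans_le le_top).ne]
  exact subset_linZeros_iff.mp heq.ge

open TopologicalSpace in
-- Generic points turn a chain in projective space into a reversed chain of homogeneous primes
-- strictly below the irrelevant ideal `m`. Appending `m` accounts for the `+ 1`, and the polynomial
-- ring has dimension `n`.
lemma topologicalKrullDim_pSpace_add_one_le (n : ℕ) :
    topologicalKrullDim (PSpace k (Fin n)) + 1 ≤ n := by
  rcases isEmpty_or_nonempty (IrreducibleCloseds (PSpace k (Fin n))) with h | h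
  · simp [topologicalKrullDim, Order.krullDim_eq_bot]
  have hn : ringKrullDim (MvPolynomial (Fin n) k) = n := by
    rw [MvPolynomial.ringKrullDim_of_isNoetherianRing]
    simp
  let 𝒜 := homogeneousSubmodule (Fin n) k
  let gen (Z : IrreducibleCloseds (PSpace k (Fin n))) : ProjectiveSpectrum 𝒜 :=
    Z.2.genericPoint
  have hgen (Z : IrreducibleCloseds (PSpace k (Fin n))) :
      closure {gen Z} = (Z : Set (PSpace k (Fin n))) :=
    Z.2.genericPoint_closure_eq.trans Z.3.closure_eq
  let f (Z : IrreducibleCloseds (PSpace k (Fin n))) : PrimeSpectrum (MvPolynomial (Fin n) k) :=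
    ⟨(gen Z).asHomogeneousIdeal.toIdeal, (gen Z).isPrime⟩
  have hle {Z Z' : IrreducibleCloseds (PSpace k (Fin n))} : f Z' ≤ f Z ↔ Z ≤ Z' := by
    refine Iff.trans (ProjectiveSpectrum.le_iff_mem_closure 𝒜 (gen Z') (gen Z)) ?_
    rw [hgen]
    change _ ↔ (Z : Set (PSpace k (Fin n))) ⊆ Z'
    rw [← hgen Z]
    exact Set.singleton_subset_iff.symm.trans Z'.3.closure_subset_iff.symm
  let m : PrimeSpectrum (MvPolynomial (Fin n) k) :=
    ⟨(HomogeneousIdeal.irrelevant 𝒜).toIdeal, RingHom.ker_isPrime (GradedRing.projZeroRingHom 𝒜)⟩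
  have hm (Z) : f Z < m := by
    refine lt_of_le_of_ne (fun g hg ↦ ?_) fun h ↦ ?_
    · have h0 : GradedRing.proj 𝒜 0 g ∈ (gen Z).asHomogeneousIdeal.toIdeal :=
        (gen Z).asHomogeneousIdeal.isHomogeneous 0 hg
      have h1 : GradedRing.proj 𝒜 0 g ∈ 𝒜 0 := SetLike.coe_mem _
      rw [show 𝒜 0 = 1 from homogeneousSubmodule_zero _, Submodule.mem_one] at h1
      obtain ⟨a, ha⟩ := h1
      change GradedRing.proj 𝒜 0 g = 0
      by_contra hne
      rw [← ha] at h0 hne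
      refine (gen Z).isPrime.ne_top (Ideal.eq_top_of_isUnit_mem _ h0 ?_)
      exact (isUnit_iff_ne_zero.mpr fun h ↦ hne (by rw [h, map_zero])).map _
    · exact (gen Z).not_irrelevant_le (congrArg PrimeSpectrum.asIdeal h).ge
  rw [← hn, topologicalKrullDim, ← Order.krullDim_withBot, ringKrullDim,
    ← Order.krullDim_orderDual (α := PrimeSpectrum _)]
  refine Order.krullDim_le_of_strictMono
    (fun Z : WithBot (IrreducibleCloseds (PSpace k (Fin n))) ↦
      OrderDual.toDual (Z.recBotCoe m f)) ?_
  intro a b hab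
  induction a with
  | bot =>
    lift b to IrreducibleCloseds (PSpace k (Fin n)) using hab.ne'
    exact hm b
  | coe a =>
    lift b to IrreducibleCloseds (PSpace k (Fin n)) using ((WithBot.bot_lt_coe a).trans hab).ne'
    have h := WithBot.coe_lt_coe.mp hab
    exact lt_of_le_not_ge (hle.mpr h.le) fun h' ↦ h.not_ge (hle.mp h')

variable {n : ℕ}

lemma finrank_linForm : Module.finrank k (LinForm k (Fin n)) = n := by
  rw [LinForm, homogeneousSubmodule_one_eq_span_X,
    finrank_span_eq_card (linearIndependent_X (Fin n) k), Fintype.card_fin]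

instance finite_linForm : Module.Finite k (LinForm k (Fin n)) := by
  rw [LinForm, homogeneousSubmodule_one_eq_span_X]
  exact Module.Finite.span_of_finite k (Set.finite_range _)

lemma _root_.Submodule.exists_le_finrank_eq {V : Type*} [AddCommGroup V] [Module k V]
    (W : Submodule k V) [Module.Finite k W] {r : ℕ} (hr : r ≤ Module.finrank k W) :
    ∃ W' ≤ W, Module.finrank k W' = r := by
  let v : Fin r → W := Module.finBasis k W ∘ Fin.castLE hr
  have hv : LinearIndependent k v :=
    (Module.finBasis k W).linearIndependent.comp _ (Fin.castLE_injective hr)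
  refine ⟨(Submodule.span k (Set.range v)).map W.subtype, Submodule.map_subtype_le _ _, ?_⟩
  rw [Submodule.finrank_map_subtype_eq, finrank_span_eq_card hv, Fintype.card_fin]

/-- Dropping one independent form strictly enlarges an irreducible linear space, until the whole
projective space is reached. -/
lemma topologicalKrullDim_linZeros_add_le (W : Submodule k (LinForm k (Fin n))) (hW : W ≠ ⊤) :
    topologicalKrullDim (linZeros W) + 1 + (Module.finrank k W : ℕ) ≤ n := by
  induction h : Module.finrank k W generalizing W with
  | zero =>
    rw [Nat.cast_zero, add_zero]
    exact (add_le_add_left (topologicalKrullDim_subspace_le _ _) 1).trans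
      (topologicalKrullDim_pSpace_add_one_le n)
  | succ r ih =>
    obtain ⟨W', hW', hr⟩ : ∃ W' < W, Module.finrank k W' = r := by
      obtain ⟨W', hle, hr⟩ := W.exists_le_finrank_eq (r.le_succ.trans h.ge)
      exact ⟨W', lt_of_le_of_ne hle fun e ↦ by subst e; omega, hr⟩
    have h1 := topologicalKrullDim_add_one_le_of_ssubset (isClosed_linZeros W)
      (isIrreducible_linZeros (hW'.trans_le le_top).ne) (linZeros_ssubset hW')
    calc _ = (topologicalKrullDim (linZeros W) + 1) + 1 + (r : ℕ) := by
          push_cast; ring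
      _ ≤ topologicalKrullDim (linZeros W') + 1 + (r : ℕ) := by gcongr
      _ ≤ n := ih W' (hW'.trans_le le_top).ne hr

/-- Dually, adding `d` independent forms one at a time gives a strict descent to a nonempty linear
space. -/
lemma le_topologicalKrullDim_linZeros (W : Submodule k (LinForm k (Fin n))) {d : ℕ}
    (hd : Module.finrank k W + (d + 1) = n) : d ≤ topologicalKrullDim (linZeros W) := by
  have hW : W ≠ ⊤ := by
    rintro rfl
    rw [finrank_top, finrank_linForm] at hd
    omega
  induction d generalizing W with
  | zero => exact zero_le_topologicalKrullDim (isIrreducible_linZeros hW).nonempty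
  | succ d ih =>
    obtain ⟨f, hf⟩ := exists_notMem_of_ne_top hW
    have hfin := Submodule.finrank_sup_span_singleton hf
    have hlt : W < W ⊔ Submodule.span k {f} :=
      left_lt_sup.mpr fun h ↦ hf (h (Submodule.mem_span_singleton_self f))
    have hne : W ⊔ Submodule.span k {f} ≠ ⊤ := fun h ↦ by
      rw [h, finrank_top, finrank_linForm] at hfin
      omega
    push_cast
    exact (add_le_add_left (ih _ (by omega) hne) 1).trans
      (topologicalKrullDim_add_one_le_of_ssubset (isClosed_linZeros _)
        (isIrreducible_linZeros hW) (linZeros_ssubset hlt))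

lemma topologicalKrullDim_linZeros {W : Submodule k (LinForm k (Fin n))} {d : ℕ}
    (hd : Module.finrank k W + (d + 1) = n) : topologicalKrullDim (linZeros W) = d := by
  have hW : W ≠ ⊤ := by
    rintro rfl
    rw [finrank_top, finrank_linForm] at hd
    omega
  refine le_antisymm ?_ (le_topologicalKrullDim_linZeros W hd)
  have h1 := topologicalKrullDim_linZeros_add_le W hW
  generalize topologicalKrullDim (linZeros W) = a at h1 ⊢
  generalize Module.finrank k W = r at h1 hd
  subst hd
  induction a with
  | bot => exact bot_le
  | coe a =>
    induction a with
    | top => exact absurd (show (⊤ : ℕ∞) + 1 + r ≤ r + (d + 1) by exact_mod_cast h1) (by simp)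
    | coe a =>
      have : a + 1 + r ≤ r + (d + 1) := by exact_mod_cast h1
      exact_mod_cast (show a ≤ d by omega)

end LinearForms

/-! ### Proper closed subsets of a curve are finite sets of closed points. -/

section Curve

open TopologicalSpace

variable {X : Type*} [TopologicalSpace X]

/-- A proper specialization `y` of `z` would give a chain `closure {y} ⊂ closure {z} ⊂ X` of length
two. -/
lemma isClosed_singleton_of_topologicalKrullDim_le_one [T0Space X] [IrreducibleSpace X]
    (hX : topologicalKrullDim X ≤ 1) {Z : Set X} (hZ : IsClosed Z) (hne : Z ≠ Set.univ)
    {z : X} (hz : z ∈ Z) : IsClosed ({z} : Set X) := by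
  rw [← closure_eq_iff_isClosed]
  refine Set.Subset.antisymm (fun y hy ↦ ?_) subset_closure
  by_contra hyz
  have h1 : closure {y} ⊂ closure {z} :=
    (closure_minimal (Set.singleton_subset_iff.mpr hy) isClosed_closure).ssubset_of_ne fun h ↦
      hyz (inseparable_iff_closure_eq.mpr h).eq
  have h2 : closure {z} ⊂ Set.univ :=
    Set.ssubset_univ_iff.mpr fun h ↦ hne <| Set.eq_univ_of_univ_subset <|
      h ▸ closure_minimal (Set.singleton_subset_iff.mpr hz) hZ
  have h3 := topologicalKrullDim_add_one_le_of_ssubset isClosed_closure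
    isIrreducible_singleton.closure h1
  have h4 := topologicalKrullDim_add_one_le_of_ssubset isClosed_closure
    (IrreducibleSpace.isIrreducible_univ X) h2
  have h5 := zero_le_topologicalKrullDim (Y := closure {y}) ⟨y, subset_closure rfl⟩
  have h6 : (0 : WithBot ℕ∞) + 1 + 1 ≤ 1 :=
    calc _ ≤ topologicalKrullDim (closure {y}) + 1 + 1 := by gcongr
      _ ≤ topologicalKrullDim (closure {z}) + 1 := by gcongr
      _ ≤ _ := h4
      _ ≤ _ := topologicalKrullDim_subspace_le _ _
      _ ≤ 1 := hX
  have h7 : 0 + 1 + 1 ≤ 1 := by exact_mod_cast h6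
  omega

lemma finite_of_isClosed_of_topologicalKrullDim_le_one [T0Space X] [QuasiSober X]
    [IrreducibleSpace X] [NoetherianSpace X]
    (hX : topologicalKrullDim X ≤ 1) {Z : Set X} (hZ : IsClosed Z) (hne : Z ≠ Set.univ) :
    Z.Finite := by
  obtain ⟨T, hT, hc, hirr, rfl⟩ := NoetherianSpace.exists_finite_set_isClosed_irreducible hZ
  refine hT.sUnion fun t ht ↦ ?_
  have h2 := (hirr t ht).genericPoint_closure_eq
  rw [(hc t ht).closure_eq] at h2
  have hmem : (hirr t ht).genericPoint ∈ t := h2.le (subset_closure rfl)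
  have h1 := isClosed_singleton_of_topologicalKrullDim_le_one hX hZ hne
    (Set.mem_sUnion_of_mem hmem ht)
  rw [h1.closure_eq] at h2
  exact h2 ▸ Set.finite_singleton _

end Curve

/-! ### Topology of projective bundles. -/

section Bundle

variable {k : Type u} [Field k] {n : ℕ} {B Λ : Scheme.{u}} {sB : B ⟶ Spec (CommRingCat.of k)}
  {π : Λ ⟶ B}

/-- Locally on the base, `π` is a base change of projective space over `Spec k`. -/
lemma IsProjectiveBundle.of_isZariskiLocalAtTarget (h : IsProjectiveBundle n sB π)
    (Q : MorphismProperty Scheme.{u}) [IsZariskiLocalAtTarget Q] [Q.IsStableUnderBaseChange]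
    (hQ : Q (PSpace.toBase k (Fin n))) : Q π := by
  choose U hU e he using h
  refine (IsZariskiLocalAtTarget.iff_of_iSup_eq_top (P := Q) U ?_).mpr fun b ↦ ?_
  · exact eq_top_iff.mpr fun b _ ↦ TopologicalSpace.Opens.mem_iSup.mpr ⟨b, hU b⟩
  · rw [← he b, Q.cancel_left_of_respectsIso]
    exact Q.pullback_snd _ _ hQ

lemma IsProjectiveBundle.isClosedMap (h : IsProjectiveBundle n sB π) : IsClosedMap π :=
  have : UniversallyClosed π := h.of_isZariskiLocalAtTarget @UniversallyClosed inferInstance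
  π.isClosedMap

lemma IsProjectiveBundle.isOpenMap (h : IsProjectiveBundle n sB π) : IsOpenMap π :=
  have : UniversallyOpen π := h.of_isZariskiLocalAtTarget @UniversallyOpen inferInstance
  π.isOpenMap

lemma IsProjectiveBundle.topologicalKrullDim_fiber [IsAlgClosed k] [LocallyOfFiniteType sB]
    (h : IsProjectiveBundle n sB π) {b : B} (hb : IsClosed ({b} : Set B)) :
    topologicalKrullDim (π ⁻¹' {b}) = topologicalKrullDim (PSpace k (Fin n)) := by
  obtain ⟨U, hU, e, he⟩ := h b
  let σ := pointOfClosedPoint sB b hb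
  have hσ : Set.range σ ⊆ Set.range U.ι := by
    rintro _ ⟨x, rfl⟩
    rw [pointOfClosedPoint_apply sB b hb]
    simpa using hU
  let s : Spec (CommRingCat.of k) ⟶ U := IsOpenImmersion.lift U.ι σ hσ
  have hs : s ≫ U.ι = σ := IsOpenImmersion.lift_fac _ _ _
  have hs1 : s ≫ U.ι ≫ sB = 𝟙 _ := by
    rw [← Category.assoc, hs]; exact pointOfClosedPoint_comp sB b hb
  have hsb (x) : U.ι (s x) = b := by
    rw [← Scheme.Hom.comp_apply, hs]; exact pointOfClosedPoint_apply sB b hb x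
  -- The closed point `b` is a rational point `s` of `U`; `t` is the slice of the trivial bundle
  -- over `s`, a topological embedding because the first projection retracts it.
  let t : PSpace k (Fin n) ⟶ pullback (PSpace.toBase k (Fin n)) (U.ι ≫ sB) :=
    pullback.lift (𝟙 _) (PSpace.toBase k (Fin n) ≫ s) (by simp [hs1])
  have ht : IsPullback t (PSpace.toBase k (Fin n)) (pullback.snd _ _) s := by
    refine IsPullback.of_right (h₁₂ := pullback.fst _ _) (h₂₂ := U.ι ≫ sB)
      (v₁₃ := PSpace.toBase k (Fin n)) ?_ (pullback.lift_snd _ _ _) (IsPullback.of_hasPullback _ _)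
    rw [hs1, pullback.lift_fst]
    exact IsPullback.of_horiz_isIso ⟨by simp⟩
  let g : PSpace k (Fin n) ⟶ Λ := t ≫ e.inv ≫ (π ⁻¹ᵁ U).ι
  have htemb : Topology.IsEmbedding t := by
    refine .of_comp t.continuous (pullback.fst (PSpace.toBase k (Fin n)) (U.ι ≫ sB)).continuous ?_
    convert! Topology.IsEmbedding.id
    ext x
    change (t ≫ pullback.fst _ _) x = x
    rw [pullback.lift_fst]
    rfl
  have hg : Topology.IsEmbedding g := by
    have h2 := (e.inv ≫ (π ⁻¹ᵁ U).ι).isOpenEmbedding.isEmbedding.comp htemb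
    exact h2
  have hrange : Set.range g = π ⁻¹' {b} := by
    have hπ (y) : π ((e.inv ≫ (π ⁻¹ᵁ U).ι) y) = U.ι (pullback.snd (PSpace.toBase k (Fin n)) (U.ι ≫ sB) y) := by
      have : (e.inv ≫ (π ⁻¹ᵁ U).ι) ≫ π = pullback.snd _ _ ≫ U.ι := by
        rw [Category.assoc, ← morphismRestrict_ι, ← he, Category.assoc, Iso.inv_hom_id_assoc]
      exact congr($this y)
    ext x
    constructor
    · rintro ⟨y, rfl⟩
      change π ((e.inv ≫ (π ⁻¹ᵁ U).ι) (t y)) = b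
      rw [hπ, ← hsb (PSpace.toBase k (Fin n) y)]
      exact congr(U.ι ($ht.w y))
    · intro hx
      have hxU : x ∈ Set.range (π ⁻¹ᵁ U).ι := by
        rw [Scheme.Opens.range_ι]
        change π x ∈ U
        rwa [show π x = b from hx]
      obtain ⟨y, rfl⟩ := hxU
      have hy : pullback.snd (PSpace.toBase k (Fin n)) (U.ι ≫ sB) (e.hom y) =
          s (IsLocalRing.closedPoint k) := by
        apply U.ι.isOpenEmbedding.injective
        rw [← hπ]
        refine Eq.trans ?_ (hsb _).symm
        have : e.hom ≫ e.inv ≫ (π ⁻¹ᵁ U).ι = (π ⁻¹ᵁ U).ι := by simp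
        exact (congr(π ($this y))).trans hx
      obtain ⟨z, hz, -⟩ := Scheme.exists_preimage_of_isPullback ht _ _ hy
      refine ⟨z, ?_⟩
      change (e.inv ≫ (π ⁻¹ᵁ U).ι) (t z) = _
      rw [show t z = e.hom y from hz]
      have : e.hom ≫ e.inv ≫ (π ⁻¹ᵁ U).ι = (π ⁻¹ᵁ U).ι := by simp
      exact congr($this y)
  rw [← hrange]
  exact (IsHomeomorph.topologicalKrullDim_eq _ hg.toHomeomorph.isHomeomorph).symm

end Bundle

/-! ### Joins of a point with a linear space. -/

section Incidence

variable {k : Type u} [Field k] [IsAlgClosed k] {ι : Type} [Finite ι]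

lemma exists_sub_smul_mem_linearFormsOn {p : PSpace k ι} (hp : IsClosed ({p} : Set (PSpace k ι)))
    {w : LinForm k ι} (hw : w ∉ linearFormsOn {p}) (h : LinForm k ι) :
    ∃ a : k, h - a • w ∈ linearFormsOn {p} := by
  obtain ⟨a, ha⟩ := exists_sub_smul_mem_of_isClosed_singleton hp w.2 h.2
    (mem_linearFormsOn_singleton.not.mp hw)
  exact ⟨a, mem_linearFormsOn_singleton.mpr ha⟩

/-- If a linear space avoids `p` and meets the line joining `p` and `q`, then `q` lies in the
span of `p` and that linear space. -/
lemma mem_linZeros_linearFormsOn_union {p q : PSpace k ι}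
    (hp : IsClosed ({p} : Set (PSpace k ι))) (hq : IsClosed ({q} : Set (PSpace k ι)))
    {L : Set (PSpace k ι)} (hL : IsLinearSpace L) (hpL : p ∉ L)
    (h : (lineJoining p q ∩ L).Nonempty) :
    q ∈ linZeros (linearFormsOn {p} ⊓ linearFormsOn L) := by
  obtain ⟨r, hr, hrL⟩ := h
  rw [lineJoining, linearSpan_eq] at hr
  rw [hL.eq_linZeros, mem_linZeros] at hpL
  push Not at hpL
  obtain ⟨w, hwL, hwp⟩ := hpL
  rw [mem_linZeros]
  rintro f ⟨hfp, hfL⟩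
  by_contra hfq
  -- Every linear form `h` would vanish at `r`. Subtracting `a • w` kills `h` at `p`; subtracting `b
  -- • f` then kills it at `q` and keeps it zero at `p`. The result vanishes on the line, and `w`,
  -- `f` vanish on `L`; both contain `r`.
  refine linearFormsOn_ne_top (Set.singleton_nonempty r) (Submodule.eq_top_iff'.mpr fun h ↦ ?_)
  obtain ⟨a, ha⟩ := exists_sub_smul_mem_linearFormsOn hp (mem_linearFormsOn_singleton.not.mpr hwp) h
  obtain ⟨b, hb⟩ := exists_sub_smul_mem_linearFormsOn hq (mem_linearFormsOn_singleton.not.mpr hfq)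
    (h - a • w)
  have hrL' : linearFormsOn L ≤ linearFormsOn {r} :=
    linearFormsOn_anti (Set.singleton_subset_iff.mpr hrL)
  have h1 : h - a • w - b • f ∈ linearFormsOn {r} := by
    rw [mem_linearFormsOn_singleton]
    refine mem_linZeros.mp hr _ fun x hx ↦ ?_
    rcases hx with rfl | rfl
    · exact (sub_mem ha (Submodule.smul_mem _ b hfp)) _ rfl
    · exact hb _ rfl
  have h2 := add_mem (add_mem h1 (Submodule.smul_mem _ b (hrL' hfL)))
    (Submodule.smul_mem _ a (hrL' hwL))
  simpa using h2

lemma finrank_linearFormsOn_singleton {n : ℕ} {p : PSpace k (Fin n)}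
    (hp : IsClosed ({p} : Set (PSpace k (Fin n)))) :
    Module.finrank k (linearFormsOn {p}) + 1 = n := by
  obtain ⟨w, hw⟩ := exists_notMem_of_ne_top (linearFormsOn_ne_top (Set.singleton_nonempty p))
  rw [← Submodule.finrank_sup_span_singleton hw]
  have : linearFormsOn {p} ⊔ Submodule.span k {w} = ⊤ := by
    refine Submodule.eq_top_iff'.mpr fun h ↦ ?_
    obtain ⟨a, ha⟩ := exists_sub_smul_mem_linearFormsOn hp hw h
    rw [← sub_add_cancel h (a • w)]
    exact add_mem (Submodule.mem_sup_left ha) (Submodule.mem_sup_right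
      (Submodule.smul_mem _ a (Submodule.mem_span_singleton_self w)))
  rw [this, finrank_top, finrank_linForm]

end Incidence

/-! ### Rulings and the parameter curve. -/

section Scroll

variable {k : Type u} [Field k] {n N : ℕ} {P : Set (PSpace k (Fin (N + 1)))} (S : Scroll k n N P)

lemma IsSmoothProjectiveCurve.isProper {B : Scheme.{u}} {sB : B ⟶ Spec (CommRingCat.of k)}
    (h : IsSmoothProjectiveCurve sB) : IsProper sB := by
  obtain ⟨M, j, hj, rfl⟩ := h.projective
  infer_instance

lemma IsSmoothProjectiveCurve.noetherianSpace {B : Scheme.{u}} {sB : B ⟶ Spec (CommRingCat.of k)}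
    (h : IsSmoothProjectiveCurve sB) : TopologicalSpace.NoetherianSpace B := by
  have := h.isProper
  have : IsLocallyNoetherian B := LocallyOfFiniteType.isLocallyNoetherian sB
  have : CompactSpace B := QuasiCompact.compactSpace_of_compactSpace sB
  have : IsNoetherian B := {}
  infer_instance

namespace Scroll

lemma ruling_eq_range (b : S.B) : S.ruling b = Set.range (S.π.fiberι b ≫ S.φ) := by
  rw [ruling, ← Scheme.Hom.range_fiberι, ← Set.range_comp]
  rfl

lemma isLinearSpace_ruling {b : S.B} (hb : IsClosed ({b} : Set S.B)) :
    IsLinearSpace (S.ruling b) := by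
  rw [ruling_eq_range]
  exact S.fibre_linear b hb

lemma ruling_subset (b : S.B) : S.ruling b ⊆ P :=
  (Set.image_subset_range _ _).trans S.range_eq.le

lemma ruling_mem_rulings {b : S.B} (hb : IsClosed ({b} : Set S.B)) : S.ruling b ∈ S.rulings :=
  ⟨b, hb, rfl⟩

lemma topologicalKrullDim_ruling [IsAlgClosed k] {b : S.B} (hb : IsClosed ({b} : Set S.B)) :
    topologicalKrullDim (S.ruling b) = topologicalKrullDim (PSpace k (Fin n)) := by
  have := S.isCurve.isProper
  have := S.fibre_closedImmersion b hb
  rw [← S.isBundle.topologicalKrullDim_fiber hb, ruling_eq_range,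
    ← IsHomeomorph.topologicalKrullDim_eq _ (S.π.fiberHomeo b).isHomeomorph]
  exact (IsHomeomorph.topologicalKrullDim_eq _
    (S.π.fiberι b ≫ S.φ).isClosedEmbedding.isEmbedding.toHomeomorph.isHomeomorph).symm

lemma jacobsonSpace_base : JacobsonSpace S.B :=
  have := S.isCurve.isProper
  LocallyOfFiniteType.jacobsonSpace S.sB

/-- A closed subset containing all but finitely many rulings contains the whole scroll. -/
lemma subset_of_forall_ruling_subset {Z : Set (PSpace k (Fin (N + 1)))} (hZ : IsClosed Z)
    {F : Set S.B} (hF : IsClosed F) (hne : F ≠ Set.univ)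
    (h : ∀ b ∉ F, IsClosed ({b} : Set S.B) → S.ruling b ⊆ Z) : P ⊆ Z := by
  have := S.jacobsonSpace_base
  have := S.isCurve.irreducible
  -- These are the parameters of rulings not contained in `Z`. If nonempty, this open set would meet
  -- `Fᶜ` in a closed point.
  have hopen : IsOpen (S.π '' (S.φ ⁻¹' Z)ᶜ) :=
    S.isBundle.isOpenMap _ (hZ.preimage S.φ.continuous).isOpen_compl
  have h1 : S.π '' (S.φ ⁻¹' Z)ᶜ ∩ Fᶜ = ∅ := by
    by_contra hU
    obtain ⟨b, ⟨⟨x, hx, rfl⟩, hbF⟩, hb⟩ := nonempty_inter_closedPoints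
      (Set.nonempty_iff_ne_empty.mpr hU) (hopen.inter hF.isOpen_compl).isLocallyClosed
    exact hx (h _ hbF hb ⟨x, rfl, rfl⟩)
  have h2 : ¬ (S.π '' (S.φ ⁻¹' Z)ᶜ).Nonempty := fun h2 ↦
    (nonempty_preirreducible_inter hopen hF.isOpen_compl h2
      (Set.nonempty_compl.mpr hne)).ne_empty h1
  rw [← S.range_eq]
  rintro _ ⟨x, rfl⟩
  by_contra hx
  exact h2 ⟨_, x, hx, rfl⟩

/-- An irreducible subset of a scroll that does not meet all rulings lies in one of them. -/
lemma exists_ruling_or_forall_ruling {A : Set (PSpace k (Fin (N + 1)))} (hA : IsClosed A)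
    (hirr : IsIrreducible A) (hAP : A ⊆ P) :
    (∃ L ∈ S.rulings, A ⊆ L) ∨ ∀ b, (A ∩ S.ruling b).Nonempty := by
  have := S.isCurve.irreducible
  have := S.isCurve.noetherianSpace
  have hcl : IsClosed (S.π '' (S.φ ⁻¹' A)) := S.isBundle.isClosedMap _ (hA.preimage S.φ.continuous)
  -- The parameters of rulings meeting `A` form a closed set: all of the curve, or finitely many
  -- closed points, whose rulings then cover `A`.
  by_cases huniv : S.π '' (S.φ ⁻¹' A) = Set.univ
  · right
    intro b
    obtain ⟨x, hx, rfl⟩ := huniv.ge (Set.mem_univ b)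
    exact ⟨S.φ x, hx, x, rfl, rfl⟩
  left
  have hfin := finite_of_isClosed_of_topologicalKrullDim_le_one S.isCurve.dim_eq_one.le hcl huniv
  have hpt {b} (hb : b ∈ S.π '' (S.φ ⁻¹' A)) : IsClosed ({b} : Set S.B) :=
    isClosed_singleton_of_topologicalKrullDim_le_one S.isCurve.dim_eq_one.le hcl huniv hb
  obtain ⟨L, hL, hAL⟩ := isIrreducible_iff_sUnion_isClosed.mp hirr
    (hfin.image S.ruling).toFinset (fun z hz ↦ by
      rw [Set.Finite.mem_toFinset] at hz
      obtain ⟨b, hb, rfl⟩ := hz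
      exact (S.isLinearSpace_ruling (hpt hb)).isClosed) (fun y hy ↦ by
      obtain ⟨x, rfl⟩ := S.range_eq.ge (hAP hy)
      rw [Set.Finite.coe_toFinset]
      exact ⟨_, ⟨S.π x, ⟨x, hy, rfl⟩, rfl⟩, x, rfl, rfl⟩)
  rw [Set.Finite.mem_toFinset] at hL
  obtain ⟨b, hb, rfl⟩ := hL
  exact ⟨_, S.ruling_mem_rulings (hpt hb), hAL⟩

end Scroll

end Scroll

/-! ### Cones in a scroll. -/

section Cone

variable {k : Type u} [Field k]

lemma finrank_linearFormsOn_of_isLinearSpace {N d : ℕ} {L : Set (PSpace k (Fin (N + 1)))}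
    (hL : IsLinearSpace L) (hne : L.Nonempty) (hd : topologicalKrullDim L = d) :
    Module.finrank k (linearFormsOn L) + (d + 1) = N + 1 := by
  have hlt := Submodule.finrank_lt (linearFormsOn_ne_top hne)
  rw [finrank_linForm] at hlt
  obtain ⟨e, he⟩ : ∃ e, Module.finrank k (linearFormsOn L) + (e + 1) = N + 1 :=
    ⟨N - Module.finrank k (linearFormsOn L), by omega⟩
  have h := topologicalKrullDim_linZeros he
  rw [← hL.eq_linZeros, hd] at h
  have : d = e := by exact_mod_cast h
  omega

lemma topologicalKrullDim_pSpace (m : ℕ) : topologicalKrullDim (PSpace k (Fin (m + 1))) = m := by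
  have h := topologicalKrullDim_linZeros (k := k) (n := m + 1) (W := ⊥) (d := m) (by simp)
  have huniv : linZeros (⊥ : Submodule k (LinForm k (Fin (m + 1)))) = Set.univ :=
    Set.eq_univ_of_forall fun x ↦ mem_linZeros.mpr fun f hf ↦ by
      rw [(Submodule.mem_bot k).mp hf]
      exact zero_mem x.asHomogeneousIdeal.toIdeal
  rw [huniv] at h
  rw [← h]
  exact (IsHomeomorph.topologicalKrullDim_eq _ (Homeomorph.Set.univ _).isHomeomorph).symm

lemma isIrreducible_lineJoining {ι : Type} (p q : PSpace k ι) : IsIrreducible (lineJoining p q) := by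
  rw [lineJoining, linearSpan_eq]
  exact isIrreducible_linZeros (linearFormsOn_ne_top (Set.insert_nonempty _ _))

lemma subset_lineJoining {ι : Type} (p q : PSpace k ι) : {p, q} ⊆ lineJoining p q := by
  rw [lineJoining, linearSpan_eq]
  exact subset_linZeros_iff.mpr le_rfl

variable {n N : ℕ} {P : Set (PSpace k (Fin (N + 1)))} (S : Scroll k n N P)

lemma Scroll.isClosed_of_mem_rulings {L : Set (PSpace k (Fin (N + 1)))} (hL : L ∈ S.rulings) :
    IsClosed L := by
  obtain ⟨b, hb, rfl⟩ := hL
  exact (S.isLinearSpace_ruling hb).isClosed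

lemma Scroll.isClosed_sUnion_rulings {p : PSpace k (Fin (N + 1))}
    (hfin : {L | L ∈ S.rulings ∧ p ∈ L}.Finite) : IsClosed (⋃₀ {L | L ∈ S.rulings ∧ p ∈ L}) := by
  rw [Set.sUnion_eq_biUnion]
  exact hfin.isClosed_biUnion fun L hL ↦ S.isClosed_of_mem_rulings hL.1

/-- If a point of a non-linear scroll lies on finitely many rulings, the parameters of the
rulings through it form a proper closed subset of the base. -/
lemma Scroll.image_preimage_singleton_ne_univ (hP : ¬ IsLinearSpace P)
    {p : PSpace k (Fin (N + 1))} (hfin : {L | L ∈ S.rulings ∧ p ∈ L}.Finite) :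
    S.π '' (S.φ ⁻¹' {p}) ≠ Set.univ := by
  intro huniv
  -- Finiteness concerns rulings as sets, not parameters. If every ruling contained `p`, finitely
  -- many would cover `P`, making `P` itself a ruling.
  have hsub : P ⊆ ⋃₀ {L | L ∈ S.rulings ∧ p ∈ L} := by
    have := S.isCurve.irreducible
    refine S.subset_of_forall_ruling_subset (S.isClosed_sUnion_rulings hfin) isClosed_empty Set.empty_ne_univ fun b _ hb ↦ ?_
    refine Set.subset_sUnion_of_mem ⟨S.ruling_mem_rulings hb, ?_⟩
    obtain ⟨x, hx, rfl⟩ := huniv.ge (Set.mem_univ b)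
    exact ⟨x, rfl, hx⟩
  obtain ⟨L, hL, hPL⟩ := isIrreducible_iff_sUnion_isClosed.mp S.isIrreducible hfin.toFinset
    (fun L hL ↦ S.isClosed_of_mem_rulings (hfin.mem_toFinset.mp hL).1)
    (by rwa [Set.Finite.coe_toFinset])
  obtain ⟨⟨b, hb, rfl⟩, -⟩ := hfin.mem_toFinset.mp hL
  exact hP (hPL.antisymm (S.ruling_subset b) ▸ S.isLinearSpace_ruling hb)

/-- A cone in a scroll lies in a ruling through its vertex, or in the span of its vertex and any
given ruling avoiding the vertex. -/
lemma Scroll.cone_subset [IsAlgClosed k] {p : PSpace k (Fin (N + 1))}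
    (hfin : {L | L ∈ S.rulings ∧ p ∈ L}.Finite) {C : Set (PSpace k (Fin (N + 1)))}
    (hcone : IsCone C p) (hirr : IsIrreducible C) (hCP : C ⊆ P)
    {b : S.B} (hb : IsClosed ({b} : Set S.B)) (hpb : p ∉ S.ruling b) :
    (∃ L ∈ S.rulings, C ⊆ L) ∨
      C ⊆ linZeros (linearFormsOn {p} ⊓ linearFormsOn (S.ruling b)) := by
  set Z := linZeros (linearFormsOn {p} ⊓ linearFormsOn (S.ruling b)) with hZ
  have hclosed : IsClosed (⋃₀ {L | L ∈ S.rulings ∧ p ∈ L} ∪ Z) :=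
    (S.isClosed_sUnion_rulings hfin).union (isClosed_linZeros _)
  have hpZ : p ∈ Z := mem_linZeros.mpr fun f hf ↦ hf.1 p rfl
  have hsub : C ⊆ ⋃₀ {L | L ∈ S.rulings ∧ p ∈ L} ∪ Z := by
    -- The cone condition speaks only of closed points, which are dense in `C`.
    rw [← JacobsonSpace.closure_inter_closedPoints hcone.isClosed]
    refine closure_minimal (fun q ⟨hqC, hq⟩ ↦ ?_) hclosed
    by_cases hqp : q = p
    · exact Or.inr (hqp ▸ hpZ)
    have hline := hcone.line_subset q hqC hq hqp
    have hlc : IsClosed (lineJoining p q) := isClosed_zeros _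
    rcases S.exists_ruling_or_forall_ruling hlc (isIrreducible_lineJoining p q)
      (hline.trans hCP) with ⟨L, hL, hlL⟩ | hall
    · exact Or.inl ⟨L, ⟨hL, hlL (subset_lineJoining p q (by simp))⟩,
        hlL (subset_lineJoining p q (by simp))⟩
    · exact Or.inr (mem_linZeros_linearFormsOn_union hcone.isClosed_vertex hq
        (S.isLinearSpace_ruling hb) hpb (hall b))
  rcases isPreirreducible_iff_isClosed_union_isClosed.mp hirr.2 _ _
    (S.isClosed_sUnion_rulings hfin) (isClosed_linZeros _) hsub
    with h | h
  · obtain ⟨L, hL, hCL⟩ := isIrreducible_iff_sUnion_isClosed.mp hirr hfin.toFinset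
      (fun L hL ↦ S.isClosed_of_mem_rulings (hfin.mem_toFinset.mp hL).1)
      (by rwa [Set.Finite.coe_toFinset])
    exact Or.inl ⟨L, (hfin.mem_toFinset.mp hL).1, hCL⟩
  · exact Or.inr h

theorem isLinearSpace_of_isCone [IsAlgClosed k] (hP : ¬ IsLinearSpace P)
    {p : PSpace k (Fin (N + 1))}
    (hfin : {L | L ∈ S.rulings ∧ p ∈ L}.Finite)
    {C : Set (PSpace k (Fin (N + 1)))} (hcone : IsCone C p)
    (hirr : IsIrreducible C) (hdim : topologicalKrullDim C + 1 = n) (hCP : C ⊆ P) :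
    IsLinearSpace C := by
  obtain ⟨m, hm, rfl⟩ : ∃ m : ℕ, topologicalKrullDim C = m ∧ n = m + 1 := by
    have h0 := zero_le_topologicalKrullDim hirr.nonempty
    generalize topologicalKrullDim C = a at h0 hdim
    induction a with
    | bot => exact absurd h0 (by simp)
    | coe a =>
      have hdim' : a + 1 = n := by exact_mod_cast hdim
      induction a with
      | top => exact absurd hdim' (by simp)
      | coe a => exact ⟨a, rfl, by exact_mod_cast hdim'.symm⟩
  have := S.isCurve.irreducible
  have hdimL {b : S.B} (hb : IsClosed ({b} : Set S.B)) :
      topologicalKrullDim (S.ruling b) = m := by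
    rw [S.topologicalKrullDim_ruling hb, topologicalKrullDim_pSpace]
  have hneL {b : S.B} (hb : IsClosed ({b} : Set S.B)) : (S.ruling b).Nonempty := by
    by_contra hne
    have h := hdimL hb
    rw [Set.not_nonempty_iff_eq_empty.mp hne, topologicalKrullDim_empty] at h
    exact WithBot.bot_ne_coe h
  have hirrL {b : S.B} (hb : IsClosed ({b} : Set S.B)) : IsIrreducible (S.ruling b) := by
    rw [(S.isLinearSpace_ruling hb).eq_linZeros]
    exact isIrreducible_linZeros (linearFormsOn_ne_top (hneL hb))
  by_cases hCL : ∃ L ∈ S.rulings, C ⊆ L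
  · obtain ⟨L, ⟨b, hb, rfl⟩, hCL⟩ := hCL
    rw [eq_of_subset_of_topologicalKrullDim_le hcone.isClosed (hirrL hb) hCL hm.ge (hdimL hb).le]
    exact S.isLinearSpace_ruling hb
  have hneW := linearFormsOn_ne_top hirr.nonempty
  have hCW : C ⊆ linZeros (linearFormsOn C) := subset_linZeros_iff.mpr le_rfl
  have hlt := Submodule.finrank_lt hneW
  rw [finrank_linForm] at hlt
  -- `e` is the dimension of the linear span of `C`, to be compared with `m = n - 1`.
  obtain ⟨e, he⟩ : ∃ e, Module.finrank k (linearFormsOn C) + (e + 1) = N + 1 :=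
    ⟨N - Module.finrank k (linearFormsOn C), by omega⟩
  have hdimW := topologicalKrullDim_linZeros he
  have hme : m ≤ e := by
    have := topologicalKrullDim_mono hCW
    rw [hm, hdimW] at this
    exact_mod_cast this
  rcases hme.eq_or_lt with rfl | hme
  · rw [eq_of_subset_of_topologicalKrullDim_le hcone.isClosed (isIrreducible_linZeros hneW) hCW
      hm.ge hdimW.le]
    exact isLinearSpace_linZeros _
  let F := S.π '' (S.φ ⁻¹' {p})
  have hF : IsClosed F :=
    S.isBundle.isClosedMap _ (hcone.isClosed_vertex.preimage S.φ.continuous)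
  have hFne : F ≠ Set.univ := S.image_preimage_singleton_ne_univ hP hfin
  have hpF {b} (hb : b ∉ F) : p ∉ S.ruling b := fun ⟨x, hx, hxp⟩ ↦ hb ⟨x, hxp, hx⟩
  -- The span of `p` and the ruling has dimension at most `m + 1` and contains the span of `C`, of
  -- dimension `e > m`; so the two coincide.
  have key {b} (hbF : b ∉ F) (hb : IsClosed ({b} : Set S.B)) :
      linearFormsOn C ≤ linearFormsOn (S.ruling b) ∧ e ≤ m + 1 := by
    have hle : linearFormsOn {p} ⊓ linearFormsOn (S.ruling b) ≤ linearFormsOn C :=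
      subset_linZeros_iff.mp <|
        (S.cone_subset hfin hcone hirr hCP hb (hpF hbF)).resolve_left hCL
    have h1 := Submodule.finrank_sup_add_finrank_inf_eq (linearFormsOn {p})
      (linearFormsOn (S.ruling b))
    have h2 := finrank_linearFormsOn_singleton hcone.isClosed_vertex
    have h3 := finrank_linearFormsOn_of_isLinearSpace (S.isLinearSpace_ruling hb) (hneL hb)
      (hdimL hb)
    have h4 := Submodule.finrank_le (linearFormsOn {p} ⊔ linearFormsOn (S.ruling b))
    rw [finrank_linForm] at h4
    have h5 := Submodule.finrank_mono hle
    have h6 := Submodule.eq_of_le_of_finrank_le hle (by omega)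
    exact ⟨h6 ▸ inf_le_right, by omega⟩
  have hPW : P ⊆ linZeros (linearFormsOn C) :=
    S.subset_of_forall_ruling_subset (isClosed_linZeros _) hF hFne fun b hbF hb ↦
      subset_linZeros_iff.mpr (key hbF hb).1
  obtain ⟨b, hbF, hb⟩ : (Fᶜ ∩ closedPoints S.B).Nonempty :=
    have := S.jacobsonSpace_base
    nonempty_inter_closedPoints (Set.nonempty_compl.mpr hFne) hF.isOpen_compl.isLocallyClosed
  have hem : e = m + 1 := le_antisymm (key hbF hb).2 hme
  refine absurd ?_ hP
  rw [eq_of_subset_of_topologicalKrullDim_le S.isClosed (isIrreducible_linZeros hneW) hPW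
    S.dim_eq.ge (hem ▸ hdimW).le]
  exact isLinearSpace_linZeros _

end Cone

end ScrollCone

end

theorem mainTheorem5 {k : Type u} [Field k] [IsAlgClosed k] [CharZero k] (n N : ℕ)
    (P : Set (ScrollCone.PSpace k (Fin (N + 1)))) (S : ScrollCone.Scroll k n N P)
    (hP : ¬ ScrollCone.IsLinearSpace P)
    (p : ScrollCone.PSpace k (Fin (N + 1))) (hp : p ∈ P)
    (hfin : {L | L ∈ S.rulings ∧ p ∈ L}.Finite)
    (C : Set (ScrollCone.PSpace k (Fin (N + 1)))) (hcone : ScrollCone.IsCone C p)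
    (hirr : IsIrreducible C) (hdim : topologicalKrullDim C + 1 = n) (hCP : C ⊆ P) :
    ScrollCone.IsLinearSpace C :=
  ScrollCone.isLinearSpace_of_isCone S hP hfin hcone hirr hdim hCP
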